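/- Let $d\ge 1$ be an integer and $L>0$. For $s\ge 0$ let $\|g\|_{H^s(\mathbb R^d)}^2=\int_{\mathbb R^d}(1+|\xi|^2)^s|\hat g(\xi)|^2\,d\xi$ for $g\in L^2(\mathbb R^d)$, where $\hat g$ is the unitary Fourier transform, $\hat g(\xi)=(2\pi)^{-d/2}\int g(x)e^{-i\langle x,\xi\rangle}\,dx$ for integrable $g$. For $f:[0,1]^d\to\mathbb R$ let $\|f\|_{H^s([0,1]^d)}$ be the infimum of $\|g\|_{H^s(\mathbb R^d)}$ over all $g\in L^2(\mathbb R^d)$ with $g=f$ a.e. on $[0,1]^d$; $H^s([0,1]^d)$ consists of the $f$ for which this is finite. Given a function $f$ on $[0,1]^d$, a law $P_X$ on $[0,1]^d$ and a law $P_\xi$ on $\mathbb R$, let $\mathcal D_n=\{(X_i,Y_i)\}_{i=1}^n$ with $Y_i=f(X_i)+\xi_i$, where $X_1,\dots,X_n\sim P_X$ and $\xi_1,\dots,\xi_n\sim P_\xi$ are all independent. An estimator $\hat f$ is, for every $n$, a measurable map sending the sample $\mathcal D_n$ to a function in $C([0,1]^d)$; it does not depend on $r$. Its adversarial risk at radius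 $r$ is $$R_A(\hat f,f)=\mathbb E_{\mathcal D_n,X}\Big[\sup_{x'\in[0,1]^d,\ \|x'-X\|\le r}|\hat f(x')-f(X)|^2\Big]\in[0,\infty],$$ where $X\sim P_X$ is independent of $\mathcal D_n$ and $\|\cdot\|$ is the Euclidean norm. **Theorem.** There is a function $f_{\mathrm{ill}}\in H^{d/2}([0,1]^d)$ with $\|f_{\mathrm{ill}}\|_{H^{d/2}([0,1]^d)}\le L$, depending only on $d$ and $L$, with the following property. Let $s>0$ (in particular, any $0<s\le d/2$) and $\sigma\ge 0$. Let $P_X$ have a Lebesgue density bounded between two positive constants on $[0,1]^d$, and let $P_\xi$ have mean zero and be $\sigma$-sub-Gaussian, i.e. $\mathbb E\,e^{\lambda\xi}\le e^{\lambda^2\sigma^2/2}$ for all $\lambda\in\mathbb R$. Let $r_0>0$. Then there do not exist an estimator $\hat f$ and a constant $M$ such that $$R_A(\hat f,f_{\mathrm{ill}})\le M\left(n^{-\frac{2s}{2s+d}}+r^{2\min(1,s)}\right)$$ for all $n\ge 1$ and all $r\in(0,r_0]$. -/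

import Mathlib

open MeasureTheory ProbabilityTheory
open scoped ENNReal NNReal FourierTransform

noncomputable section

/-- The closed unit cube `[0,1]^d`. -/
def unitCube (d : ℕ) : Set (EuclideanSpace ℝ (Fin d)) :=
  {x | ∀ i, x i ∈ Set.Icc (0 : ℝ) 1}

/-- The closed unit cube as a space, with the Euclidean distance inherited from `ℝ^d`. -/
abbrev UnitCube (d : ℕ) : Type := ↥(unitCube d)

/-- Lebesgue measure on the cube. -/
def cubeVolume (d : ℕ) : Measure (UnitCube d) :=
  (volume : Measure (EuclideanSpace ℝ (Fin d))).comap Subtype.val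

/-- The norm `‖g‖_{H^s(ℝ^d)} = (∫ (1 + |ξ|²)^s |ĝ(ξ)|² dξ)^{1/2}` of `g ∈ L²(ℝ^d)`, with value `∞`
when `g` is not in `H^s(ℝ^d)`; here `ĝ(ξ) = (2π)^{-d/2} ∫ g(x) e^{-i⟨x,ξ⟩} dx`.
Mathlib's `𝓕` on `L²` extends `𝓕 g (η) = ∫ g(x) e^{-2πi⟨x,η⟩} dx`, so that
`ĝ(ξ) = (2π)^{-d/2} 𝓕 g (ξ / 2π)`; the substitution `ξ = 2πη` turns the integral above into the
one below. -/
def sobolevNorm {d : ℕ} (s : ℝ)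
    (g : Lp ℂ 2 (volume : Measure (EuclideanSpace ℝ (Fin d)))) : ℝ≥0∞ :=
  (∫⁻ η : EuclideanSpace ℝ (Fin d),
    ENNReal.ofReal ((1 + (2 * Real.pi * ‖η‖) ^ 2) ^ s) *
      ‖(𝓕 g : Lp ℂ 2 (volume : Measure (EuclideanSpace ℝ (Fin d)))) η‖ₑ ^ 2) ^ (1 / 2 : ℝ)

/-- The quotient norm `‖f‖_{H^s([0,1]^d)}`: the infimum of `‖g‖_{H^s(ℝ^d)}` over all `g` that agree
with `f` almost everywhere on the cube. It is finite exactly when `f ∈ H^s([0,1]^d)`. -/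
def cubeSobolevNorm {d : ℕ} (s : ℝ) (f : UnitCube d → ℝ) : ℝ≥0∞ :=
  ⨅ (g : Lp ℂ 2 (volume : Measure (EuclideanSpace ℝ (Fin d))))
    (_ : ∀ᵐ x : UnitCube d ∂(cubeVolume d), g (x : EuclideanSpace ℝ (Fin d)) = (f x : ℂ)), sobolevNorm s g

/-- The Sobolev ball of radius `L` in `H^s([0,1]^d)`. -/
def sobolevBall (d : ℕ) (s L : ℝ) : Set (UnitCube d → ℝ) :=
  {f | cubeSobolevNorm s f ≤ ENNReal.ofReal L}

/-- Covariate laws: probability measures on the cube with a Lebesgue density that is bounded away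
from zero and infinity. -/
def IsCovariateLaw {d : ℕ} (μ : Measure (UnitCube d)) : Prop :=
  IsProbabilityMeasure μ ∧
    ∃ (p : UnitCube d → ℝ) (c C : ℝ), Measurable p ∧ 0 < c ∧ (∀ x, c ≤ p x ∧ p x ≤ C) ∧
      μ = (cubeVolume d).withDensity (fun x => ENNReal.ofReal (p x))

/-- Noise laws: centred `σ`-sub-Gaussian probability measures on `ℝ`. -/
def IsNoiseLaw (σ : ℝ≥0) (ν : Measure ℝ) : Prop :=
  IsProbabilityMeasure ν ∧ ∫ e, e ∂ν = 0 ∧ HasSubgaussianMGF (fun e : ℝ => e) (σ ^ 2) ν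

/-- A (non-randomized) estimator: for every sample size `n`, a measurable map from samples
`(X_i, Y_i)_{i < n}` to continuous functions on the cube. Measurability of all evaluations is
measurability for the Borel σ-algebra of the uniform norm, as the cube is compact and metrizable. -/
def IsEstimator {d : ℕ} (F : (n : ℕ) → (Fin n → UnitCube d × ℝ) → C(UnitCube d, ℝ)) : Prop :=
  ∀ (n : ℕ) (x : UnitCube d), Measurable fun D => F n D x

/-- The adversarial risk `E sup_{x' ∈ [0,1]^d, ‖x' - X‖ ≤ r} |F(D)(x') - f(X)|²`, where the sample
`D = (X_i, f(X_i) + ξ_i)_{i < n}` is built from independent `X_i ∼ μ` and `ξ_i ∼ ν`, and the test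
point `X ∼ μ` is independent of `D`. The variable `z` is the vector of pairs `(X_i, ξ_i)`. -/
def adversarialRisk {d n : ℕ} (μ : Measure (UnitCube d)) (ν : Measure ℝ) (r : ℝ)
    (F : (Fin n → UnitCube d × ℝ) → C(UnitCube d, ℝ)) (f : UnitCube d → ℝ) : ℝ≥0∞ :=
  ∫⁻ z, ∫⁻ x, ⨆ x' ∈ Metric.closedBall x r,
      ENNReal.ofReal ((F (fun i => ((z i).1, f (z i).1 + (z i).2)) x' - f x) ^ 2) ∂μ
    ∂(Measure.pi fun _ : Fin n => μ.prod ν)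

end

/-! The space `H^{d/2}` just fails to embed in `L^∞`: it contains `f = ∑ c_k exp(-π 16^k ‖x‖²)` with
`c_k = ε / (k + 1)`. Near the origin `f` exceeds a multiple of any harmonic partial sum, so it blows
up there. The transforms `φ_k` of the Gaussians have integral 1, and their sum is at most `C (1 +
|2πη|²)^{-d/2}`. Cauchy–Schwarz, `(∑ c_k φ_k)² ≤ (∑ φ_k)(∑ c_k² φ_k)`, therefore bounds the squared
Sobolev norm by `C ∑ c_k² < ∞` (`exists_mem_sobolevBall_unbounded`).

Suppose an estimator satisfied the bound. Letting `n → ∞` with radius `r₀ / n` makes it converge to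
`f` in mean square, while at radius `r₀` its risk stays below a fixed `Q`. But where the estimator
follows the peak of `f`, every test point within `r₀` at which `f` is moderate sees that peak in its
supremum. Since the peak is arbitrarily high, the risk at radius `r₀` cannot stay bounded
(`le_adversarialRisk_add_adversarialRisk`). -/

/-! ### Dilated Gaussians and their Fourier transforms -/

open SchwartzMap in
/-- On `L¹ ∩ L²` the `L²` Fourier transform is given by the Fourier integral. -/
theorem fourier_toLp_eq_of_integrable {V : Type*} [NormedAddCommGroup V] [InnerProductSpace ℝ V]
    [FiniteDimensional ℝ V] [MeasurableSpace V] [BorelSpace V] {f : V → ℂ}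
    (hf1 : Integrable f) (hf : MemLp f 2) (hF : MemLp (𝓕 f) 2) :
    𝓕 (hf.toLp f) = hF.toLp (𝓕 f) := by
  -- An `L²` function is determined by its pairings with Schwartz functions. There the transform
  -- moves onto the test function, and Fubini moves it back onto the integrable `f`.
  have hinj := LinearMap.ker_eq_bot.1
    (Lp.ker_toTemperedDistributionCLM_eq_bot (E := V) (F := ℂ) (μ := volume) (p := 2))
  apply hinj
  change ((𝓕 (hf.toLp f) : Lp ℂ 2 (volume : Measure V)) : 𝓢'(V, ℂ)) =
    ((hF.toLp (𝓕 f) : Lp ℂ 2 (volume : Measure V)) : 𝓢'(V, ℂ))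
  rw [← Lp.fourier_toTemperedDistribution_eq]
  ext φ
  rw [TemperedDistribution.fourier_apply, Lp.toTemperedDistribution_apply,
    Lp.toTemperedDistribution_apply]
  have h1 : ∫ x, (𝓕 φ) x • (hf.toLp f) x = ∫ x, (𝓕 φ) x • f x := by
    apply integral_congr_ae
    filter_upwards [hf.coeFn_toLp] with x hx
    rw [hx]
  have h2 : ∫ x, φ x • (hF.toLp (𝓕 f)) x = ∫ x, φ x • (𝓕 f) x := by
    apply integral_congr_ae
    filter_upwards [hF.coeFn_toLp] with x hx
    rw [hx]
  rw [h1, h2]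
  have h3 := VectorFourier.integral_fourierIntegral_smul_eq_flip (L := innerₗ V)
      Real.continuous_fourierChar continuous_inner (φ.integrable (μ := volume)) hf1
  rw [flip_innerₗ] at h3
  exact h3

/-- The Gaussian `exp (-π 16 ^ k ‖x‖ ^ 2)`. -/
noncomputable def dilatedGaussian (d k : ℕ) (x : EuclideanSpace ℝ (Fin d)) : ℝ :=
  Real.exp (-(Real.pi * 16 ^ k) * ‖x‖ ^ 2)

/-- The Fourier transform of `dilatedGaussian d k`. -/
noncomputable def dilatedGaussianFourier (d k : ℕ) (η : EuclideanSpace ℝ (Fin d)) : ℝ :=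
  ((4 : ℝ) ^ k)⁻¹ ^ d * Real.exp (-(Real.pi / 16 ^ k) * ‖η‖ ^ 2)

theorem integral_exp_neg_mul_sq_norm_euclidean {d : ℕ} {c : ℝ} (hc : 0 < c) :
    ∫ x : EuclideanSpace ℝ (Fin d), Real.exp (-(Real.pi * c ^ 2) * ‖x‖ ^ 2) = c⁻¹ ^ d := by
  rw [GaussianFourier.integral_rexp_neg_mul_sq_norm (by positivity)]
  have h1 : Real.pi / (Real.pi * c ^ 2) = c⁻¹ ^ (2 : ℝ) := by
    rw [Real.rpow_ofNat]
    field_simp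
  rw [h1, ← Real.rpow_mul (by positivity), finrank_euclideanSpace, Fintype.card_fin,
    mul_div_cancel₀ _ (two_ne_zero), Real.rpow_natCast]

theorem integrable_exp_neg_mul_sq_norm {d : ℕ} {b : ℝ} (hb : 0 < b) :
    Integrable fun x : EuclideanSpace ℝ (Fin d) => Real.exp (-b * ‖x‖ ^ 2) := by
  have h := (GaussianFourier.integrable_cexp_neg_mul_sq_norm_add (V := EuclideanSpace ℝ (Fin d))
    (b := (b : ℂ)) (by simpa using hb) 0 0).re
  refine h.congr (Filter.Eventually.of_forall fun x => ?_)
  simp only [zero_mul, add_zero]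
  rw [← Complex.ofReal_neg, ← Complex.ofReal_pow, ← Complex.ofReal_mul, ← Complex.ofReal_exp]
  exact Complex.ofReal_re _

theorem memLp_two_exp_neg_mul_sq_norm {d : ℕ} {b : ℝ} (hb : 0 < b) :
    MemLp (fun x : EuclideanSpace ℝ (Fin d) => (Real.exp (-b * ‖x‖ ^ 2) : ℂ)) 2 := by
  rw [memLp_two_iff_integrable_sq_norm (by fun_prop)]
  refine (integrable_exp_neg_mul_sq_norm (d := d) (b := 2 * b) (by positivity)).congr
    (Filter.Eventually.of_forall fun x => ?_)
  simp only [Complex.norm_real, Real.norm_eq_abs, sq_abs, ← Real.exp_nat_mul]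
  congr 1
  push_cast
  ring

theorem memLp_dilatedGaussian (d k : ℕ) :
    MemLp (fun x => (dilatedGaussian d k x : ℂ)) 2 :=
  memLp_two_exp_neg_mul_sq_norm (by positivity)

theorem memLp_dilatedGaussianFourier (d k : ℕ) :
    MemLp (fun x => (dilatedGaussianFourier d k x : ℂ)) 2 := by
  have h := (memLp_two_exp_neg_mul_sq_norm (d := d) (b := Real.pi / 16 ^ k)
    (by positivity)).const_mul ((((4 : ℝ) ^ k)⁻¹ ^ d : ℝ) : ℂ)
  simpa [dilatedGaussianFourier] using h

theorem fourier_dilatedGaussian (d k : ℕ) :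
    𝓕 (fun x => (dilatedGaussian d k x : ℂ)) = fun η => (dilatedGaussianFourier d k η : ℂ) := by
  have h16 : ((16 : ℝ) ^ k) = (4 ^ k) ^ 2 := by
    rw [← pow_mul, mul_comm, pow_mul]; norm_num
  funext η
  have hb : 0 < (((Real.pi * 16 ^ k : ℝ) : ℂ)).re := by
    rw [Complex.ofReal_re]; positivity
  have h := fourier_gaussian_innerProductSpace hb η
  have h1 : (fun x : EuclideanSpace ℝ (Fin d) => (dilatedGaussian d k x : ℂ)) =
      fun v => Complex.exp (-((Real.pi * 16 ^ k : ℝ) : ℂ) * ‖v‖ ^ 2) := by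
    funext v
    simp [dilatedGaussian]
  rw [h1, h, dilatedGaussianFourier, finrank_euclideanSpace, Fintype.card_fin,
    Complex.ofReal_mul (((4 : ℝ) ^ k)⁻¹ ^ d)]
  congr 1
  · have h2 : (Real.pi : ℂ) / ((Real.pi * 16 ^ k : ℝ) : ℂ) = (((4 ^ k)⁻¹ ^ 2 : ℝ) : ℂ) := by
      rw [← Complex.ofReal_div, h16]
      congr 1
      field_simp
    have h3 : ((d : ℂ) / 2) = ((d / 2 : ℝ) : ℂ) := by push_cast; rfl
    rw [h2, h3, ← Complex.ofReal_cpow (by positivity), ← Real.rpow_natCast ((4 ^ k)⁻¹) 2,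
      ← Real.rpow_mul (by positivity), show ((2 : ℕ) : ℝ) * (d / 2) = d by push_cast; ring,
      Real.rpow_natCast]
  · rw [Complex.ofReal_exp]
    congr 1
    push_cast
    have : (Real.pi : ℂ) ≠ 0 := by exact_mod_cast Real.pi_ne_zero
    field_simp

/-- The squared norm is `(√2 · 4^k)^{-d}`, at most `4^{-k}` because `d ≥ 1`. This geometric decay
makes the series converge absolutely in `L²` for bounded coefficients. -/
theorem norm_toLp_dilatedGaussian_le {d : ℕ} (hd : 1 ≤ d) (k : ℕ) :
    ‖(memLp_dilatedGaussian d k).toLp‖ ≤ (1 / 2 : ℝ) ^ k := by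
  have h16 : ((16 : ℝ) ^ k) = (4 ^ k) ^ 2 := by
    rw [← pow_mul, mul_comm, pow_mul]; norm_num
  have h4 : ((4 : ℝ) ^ k) = (2 ^ k) ^ 2 := by
    rw [← pow_mul, mul_comm, pow_mul]; norm_num
  have h0 : ‖(memLp_dilatedGaussian d k).toLp‖ ^ 2 = (√2 * 4 ^ k)⁻¹ ^ d := by
    rw [← integral_exp_neg_mul_sq_norm_euclidean (by positivity), ← real_inner_self_eq_norm_sq]
    have := MeasureTheory.L2.inner_def (𝕜 := ℂ) ((memLp_dilatedGaussian d k).toLp)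
      ((memLp_dilatedGaussian d k).toLp)
    rw [inner_self_eq_norm_sq_to_K] at this
    rw [real_inner_self_eq_norm_sq, ← Complex.ofReal_inj]
    push_cast
    refine Eq.trans this ?_
    rw [← integral_complex_ofReal]
    apply integral_congr_ae
    filter_upwards [(memLp_dilatedGaussian d k).coeFn_toLp] with x hx
    rw [hx, inner_self_eq_norm_sq_to_K]
    simp only [Complex.norm_real, dilatedGaussian, Real.norm_eq_abs, Real.abs_exp]
    norm_cast
    rw [← Real.exp_nat_mul, mul_pow, Real.sq_sqrt (by norm_num)]
    congr 2
    push_cast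
    rw [h16]
    ring
  have h1 : (√2 * 4 ^ k)⁻¹ ≤ ((4 : ℝ) ^ k)⁻¹ := by
    apply inv_anti₀ (by positivity)
    have : 1 ≤ √2 := Real.one_le_sqrt.2 (by norm_num)
    nlinarith [show (0 : ℝ) < 4 ^ k by positivity]
  have h2 : ((4 : ℝ) ^ k)⁻¹ ≤ 1 := inv_le_one_of_one_le₀ (one_le_pow₀ (by norm_num))
  have h3 : ((1 / 2 : ℝ) ^ k) ^ 2 = ((4 : ℝ) ^ k)⁻¹ := by
    rw [h4, one_div, inv_pow, inv_pow]
  refine le_of_sq_le_sq ?_ (by positivity)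
  rw [h0, h3]
  calc (√2 * 4 ^ k)⁻¹ ^ d ≤ ((4 : ℝ) ^ k)⁻¹ ^ d := by gcongr
    _ ≤ ((4 : ℝ) ^ k)⁻¹ ^ 1 := pow_le_pow_of_le_one (by positivity) h2 hd
    _ = _ := pow_one _

theorem integral_dilatedGaussianFourier (d k : ℕ) :
    ∫ η, dilatedGaussianFourier d k η = 1 := by
  have h16 : ((16 : ℝ) ^ k) = (4 ^ k) ^ 2 := by
    rw [← pow_mul, mul_comm, pow_mul]; norm_num
  simp only [dilatedGaussianFourier]
  rw [integral_const_mul, h16, div_eq_mul_inv, ← inv_pow ((4 : ℝ) ^ k) 2,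
    integral_exp_neg_mul_sq_norm_euclidean (by positivity), ← mul_pow, inv_inv,
    inv_mul_cancel₀ (by positivity), one_pow]

theorem dilatedGaussianFourier_nonneg {d k : ℕ} (η : EuclideanSpace ℝ (Fin d)) :
    0 ≤ dilatedGaussianFourier d k η := by
  unfold dilatedGaussianFourier; positivity

/-! ### Uniform weighted bound for the sum of the transforms -/

/-- A polynomial-times-Gaussian bound. -/
theorem exists_pow_mul_exp_neg_sq_le (d : ℕ) (hd : 1 ≤ d) :
    ∃ C : ℝ, 0 < C ∧ ∀ u : ℝ, 0 < u →
      u ^ d * Real.exp (-u ^ 2 / (4 * Real.pi)) ≤ C * (u / (1 + u) - u / (4 + u)) := by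
  set P := 4 * Real.pi with hP
  have hP0 : 0 < P := by positivity
  refine ⟨4 * ((d + 1).factorial * P ^ (d + 1) * Real.exp (2 / P)), by positivity, fun u hu => ?_⟩
  obtain ⟨m, rfl⟩ : ∃ m, d = m + 1 := ⟨d - 1, by omega⟩
  -- The power `(1 + u)^(d+1)` is absorbed by `exp((1 + u) / P)`, and `1 + u - u² ≤ 2` then leaves
  -- only the factor `exp(2 / P)`.
  have h1 := Real.pow_div_factorial_le_exp ((1 + u) / P) (by positivity) (m + 1 + 1)
  rw [div_pow, div_div, div_le_iff₀ (by positivity)] at h1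
  have h2 : Real.exp ((1 + u) / P) * Real.exp (-u ^ 2 / P) ≤ Real.exp (2 / P) := by
    rw [← Real.exp_add, ← add_div]
    apply Real.exp_le_exp.2
    gcongr
    nlinarith [sq_nonneg (u - 1 / 2)]
  have h3 : u / (1 + u) - u / (4 + u) = 3 * u / ((1 + u) * (4 + u)) := by
    field_simp
    ring
  rw [h3, ← mul_div_assoc, le_div_iff₀ (by positivity)]
  have h4 : u ^ m ≤ (1 + u) ^ m := by gcongr; linarith
  calc u ^ (m + 1) * Real.exp (-u ^ 2 / P) * ((1 + u) * (4 + u))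
      ≤ u ^ (m + 1) * Real.exp (-u ^ 2 / P) * ((1 + u) * (4 * (1 + u))) := by
        gcongr; linarith
    _ = 4 * u * (u ^ m * (1 + u) ^ 2 * Real.exp (-u ^ 2 / P)) := by ring
    _ ≤ 4 * u * ((1 + u) ^ m * (1 + u) ^ 2 * Real.exp (-u ^ 2 / P)) := by gcongr
    _ = 4 * u * ((1 + u) ^ (m + 1 + 1) * Real.exp (-u ^ 2 / P)) := by ring
    _ ≤ 4 * u * ((Real.exp ((1 + u) / P) * (P ^ (m + 1 + 1) * (m + 1 + 1).factorial)) *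
          Real.exp (-u ^ 2 / P)) := by gcongr
    _ = 4 * u * (P ^ (m + 1 + 1) * (m + 1 + 1).factorial) *
          (Real.exp ((1 + u) / P) * Real.exp (-u ^ 2 / P)) := by ring
    _ ≤ 4 * u * (P ^ (m + 1 + 1) * (m + 1 + 1).factorial) * Real.exp (2 / P) := by gcongr
    _ ≤ 3 * (4 * u * (P ^ (m + 1 + 1) * (m + 1 + 1).factorial) * Real.exp (2 / P)) :=
        le_mul_of_one_le_left (by positivity) (by norm_num)
    _ = _ := by ring

/-- The Fourier transforms of the dilated Gaussians sum up to `O((1 + ‖η‖ ^ 2) ^ (-d / 2))`. -/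
theorem exists_weight_mul_sum_le (d : ℕ) (hd : 1 ≤ d) :
    ∃ C : ℝ, 0 < C ∧ ∀ (η : EuclideanSpace ℝ (Fin d)) (n : ℕ),
      (1 + (2 * Real.pi * ‖η‖) ^ 2) ^ ((d : ℝ) / 2) *
        ∑ k ∈ Finset.range n, dilatedGaussianFourier d k η ≤ C := by
  obtain ⟨C, hC, hle⟩ := exists_pow_mul_exp_neg_sq_le d hd
  refine ⟨Real.exp 1 * C, by positivity, fun η n => ?_⟩
  set R := √(1 + (2 * Real.pi * ‖η‖) ^ 2) with hR
  have hR0 : 0 < R := Real.sqrt_pos.2 (by positivity)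
  have hR2 : R ^ 2 = 1 + (2 * Real.pi * ‖η‖) ^ 2 := Real.sq_sqrt (by positivity)
  have hw : (1 + (2 * Real.pi * ‖η‖) ^ 2) ^ ((d : ℝ) / 2) = R ^ d := by
    rw [← hR2, ← Real.rpow_natCast R 2, ← Real.rpow_mul hR0.le]
    rw [show ((2 : ℕ) : ℝ) * ((d : ℝ) / 2) = d by push_cast; ring, Real.rpow_natCast]
  -- With `u = R / 4^k`, passing to `k + 1` turns `u / (1 + u)` into `u / (4 + u)`, so the bounds
  -- telescope in `k` to at most `exp 1 * C`, whatever `R` is.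
  have hterm (k : ℕ) : R ^ d * dilatedGaussianFourier d k η ≤
      Real.exp 1 * C * ((R / 4 ^ k) / (1 + R / 4 ^ k) - (R / 4 ^ (k + 1)) / (1 + R / 4 ^ (k + 1))) := by
    have h16 : ((16 : ℝ) ^ k) = (4 ^ k) ^ 2 := by
      rw [← pow_mul, mul_comm, pow_mul]; norm_num
    have h1 := hle (R / 4 ^ k) (by positivity)
    have h2 : (R / 4 ^ (k + 1)) / (1 + R / 4 ^ (k + 1)) = (R / 4 ^ k) / (4 + R / 4 ^ k) := by
      rw [pow_succ]
      field_simp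
    rw [h2, mul_assoc]
    -- The factor `exp 1` pays for the summand 1 in `R² = 1 + (2π‖η‖)²`.
    have h3 : Real.exp (-(Real.pi / 16 ^ k) * ‖η‖ ^ 2) ≤
        Real.exp 1 * Real.exp (-(R / 4 ^ k) ^ 2 / (4 * Real.pi)) := by
      rw [← Real.exp_add]
      apply Real.exp_le_exp.2
      rw [div_pow, hR2, ← h16]
      have h5 : (1 : ℝ) ≤ 16 ^ k := one_le_pow₀ (by norm_num)
      have h6 : 1 / (16 ^ k * (4 * Real.pi)) ≤ 1 := by
        rw [div_le_one (by positivity)]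
        nlinarith [Real.pi_gt_three]
      have h7 : -((1 + (2 * Real.pi * ‖η‖) ^ 2) / 16 ^ k) / (4 * Real.pi) =
        -(1 / (16 ^ k * (4 * Real.pi))) + -(Real.pi / 16 ^ k) * ‖η‖ ^ 2 := by
        field_simp
        ring
      rw [h7]
      linarith
    calc R ^ d * dilatedGaussianFourier d k η
        = (R / 4 ^ k) ^ d * Real.exp (-(Real.pi / 16 ^ k) * ‖η‖ ^ 2) := by
          rw [dilatedGaussianFourier, div_pow, div_eq_mul_inv, inv_pow]; ring
      _ ≤ (R / 4 ^ k) ^ d * (Real.exp 1 * Real.exp (-(R / 4 ^ k) ^ 2 / (4 * Real.pi))) := by gcongr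
      _ = Real.exp 1 * ((R / 4 ^ k) ^ d * Real.exp (-(R / 4 ^ k) ^ 2 / (4 * Real.pi))) := by ring
      _ ≤ _ := by gcongr
  rw [hw, Finset.mul_sum]
  refine (Finset.sum_le_sum fun k _ => hterm k).trans ?_
  rw [← Finset.mul_sum, Finset.sum_range_sub' (fun k => (R / 4 ^ k) / (1 + R / 4 ^ k))]
  apply mul_le_of_le_one_right (by positivity)
  have h1 : (R / 4 ^ 0) / (1 + R / 4 ^ 0) ≤ 1 := by
    rw [div_le_one (by positivity)]; linarith
  have h2 : 0 ≤ (R / 4 ^ n) / (1 + R / 4 ^ n) := by positivity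
  linarith

theorem measurableSet_unitCube (d : ℕ) : MeasurableSet (unitCube d) := by
  rw [unitCube, Set.ofPred_forall]
  exact MeasurableSet.iInter fun i => measurableSet_Icc.preimage (by fun_prop)

theorem ae_cubeVolume_of_ae {d : ℕ} {p : EuclideanSpace ℝ (Fin d) → Prop} (h : ∀ᵐ x, p x) :
    ∀ᵐ x : UnitCube d ∂cubeVolume d, p x := by
  have he : MeasurableEmbedding (Subtype.val : UnitCube d → _) :=
    MeasurableEmbedding.subtype_coe (measurableSet_unitCube d)
  rw [← he.ae_map_iff, cubeVolume, he.map_comap]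
  exact ae_restrict_of_ae h

/-! ### Sobolev norm of a Gaussian series -/

/-- Cauchy–Schwarz for the superposition of the dilated Gaussians. -/
theorem weight_mul_sq_sum_le {d : ℕ} {C : ℝ}
    (hC : ∀ (η : EuclideanSpace ℝ (Fin d)) (n : ℕ),
      (1 + (2 * Real.pi * ‖η‖) ^ 2) ^ ((d : ℝ) / 2) *
        ∑ k ∈ Finset.range n, dilatedGaussianFourier d k η ≤ C)
    (c : ℕ → ℝ) (η : EuclideanSpace ℝ (Fin d)) (n : ℕ) :
    (1 + (2 * Real.pi * ‖η‖) ^ 2) ^ ((d : ℝ) / 2) *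
        (∑ k ∈ Finset.range n, c k * dilatedGaussianFourier d k η) ^ 2 ≤
      ∑ k ∈ Finset.range n, C * c k ^ 2 * dilatedGaussianFourier d k η := by
  have h1 := Finset.sum_sq_le_sum_mul_sum_of_sq_le_mul (Finset.range n)
    (r := fun k => c k * dilatedGaussianFourier d k η)
    (f := fun k => dilatedGaussianFourier d k η)
    (g := fun k => c k ^ 2 * dilatedGaussianFourier d k η)
    (fun k _ => dilatedGaussianFourier_nonneg η)
    (fun k _ => mul_nonneg (sq_nonneg _) (dilatedGaussianFourier_nonneg η))
    (fun k _ => le_of_eq (by ring))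
  calc _ ≤ (1 + (2 * Real.pi * ‖η‖) ^ 2) ^ ((d : ℝ) / 2) *
        ((∑ k ∈ Finset.range n, dilatedGaussianFourier d k η) *
          ∑ k ∈ Finset.range n, c k ^ 2 * dilatedGaussianFourier d k η) := by gcongr
    _ ≤ C * ∑ k ∈ Finset.range n, c k ^ 2 * dilatedGaussianFourier d k η := by
        rw [← mul_assoc]
        exact mul_le_mul_of_nonneg_right (hC η n) (Finset.sum_nonneg fun k _ =>
          mul_nonneg (sq_nonneg _) (dilatedGaussianFourier_nonneg η))
    _ = _ := by
        rw [Finset.mul_sum]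
        exact Finset.sum_congr rfl fun k _ => by ring

/-- The `L²` function `∑ k, c k * exp (-π 16 ^ k ‖x‖ ^ 2)`. -/
noncomputable def gaussianSeries (d : ℕ) (c : ℕ → ℝ) :
    Lp ℂ 2 (volume : Measure (EuclideanSpace ℝ (Fin d))) :=
  ∑' k, (c k : ℂ) • (memLp_dilatedGaussian d k).toLp

theorem summable_norm_smul_dilatedGaussian {d : ℕ} (hd : 1 ≤ d) {c : ℕ → ℝ} {B : ℝ}
    (hc : ∀ k, |c k| ≤ B) :
    Summable fun k => ‖(c k : ℂ) • (memLp_dilatedGaussian d k).toLp‖ := by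
  refine Summable.of_nonneg_of_le (fun k => norm_nonneg _) (fun k => ?_)
    ((summable_geometric_of_lt_one (by norm_num) (by norm_num : (1 / 2 : ℝ) < 1)).mul_left B)
  rw [norm_smul, Complex.norm_real]
  exact mul_le_mul (hc k) (norm_toLp_dilatedGaussian_le hd k) (norm_nonneg _)
    ((abs_nonneg _).trans (hc k))

/-- Absolute summability of the `L²` norms gives pointwise convergence almost everywhere. -/
theorem gaussianSeries_ae_hasSum {d : ℕ} (hd : 1 ≤ d) {c : ℕ → ℝ} {B : ℝ}
    (hc : ∀ k, |c k| ≤ B) :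
    ∀ᵐ x, HasSum (fun k => ((c k * dilatedGaussian d k x : ℝ) : ℂ)) (gaussianSeries d c x) := by
  have h := Lp.hasSum_coeFn_tsum
    (tsum_enorm_ne_top_iff_summable_norm.2 (summable_norm_smul_dilatedGaussian hd hc))
  have h1 : ∀ᵐ x, ∀ k, ((c k : ℂ) • (memLp_dilatedGaussian d k).toLp :
      Lp ℂ 2 (volume : Measure (EuclideanSpace ℝ (Fin d)))) x =
      ((c k * dilatedGaussian d k x : ℝ) : ℂ) := by
    rw [ae_all_iff]
    intro k
    filter_upwards [Lp.coeFn_smul (c k : ℂ) (memLp_dilatedGaussian d k).toLp,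
      (memLp_dilatedGaussian d k).coeFn_toLp] with x hx hx'
    rw [hx, Pi.smul_apply, hx', smul_eq_mul, Complex.ofReal_mul]
  filter_upwards [h, h1] with x hx hx1
  simp only [hx1] at hx
  exact hx

theorem fourier_gaussianSeries_ae_hasSum {d : ℕ} (hd : 1 ≤ d) {c : ℕ → ℝ} {B : ℝ}
    (hc : ∀ k, |c k| ≤ B) :
    ∀ᵐ η, HasSum (fun k => ((c k * dilatedGaussianFourier d k η : ℝ) : ℂ))
      ((𝓕 (gaussianSeries d c) : Lp ℂ 2 (volume : Measure (EuclideanSpace ℝ (Fin d)))) η) := by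
  have hs := summable_norm_smul_dilatedGaussian hd hc
  have hterm (k : ℕ) : 𝓕 ((c k : ℂ) • (memLp_dilatedGaussian d k).toLp) =
      (c k : ℂ) • (memLp_dilatedGaussianFourier d k).toLp := by
    have hi : Integrable fun x => (dilatedGaussian d k x : ℂ) :=
      (integrable_exp_neg_mul_sq_norm (by positivity)).ofReal
    rw [FourierTransform.fourier_smul, fourier_toLp_eq_of_integrable hi _
      (by rw [fourier_dilatedGaussian]; exact memLp_dilatedGaussianFourier d k)]
    congr 2
    exact fourier_dilatedGaussian d k
  have htsum : 𝓕 (gaussianSeries d c) =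
      ∑' k, (c k : ℂ) • (memLp_dilatedGaussianFourier d k).toLp := by
    have h := (Lp.fourierTransformₗᵢ (EuclideanSpace ℝ (Fin d)) ℂ).toContinuousLinearEquiv.map_tsum
      (L := SummationFilter.unconditional ℕ) (f := fun k => (c k : ℂ) • (memLp_dilatedGaussian d k).toLp)
    refine Eq.trans h ?_
    exact tsum_congr hterm
  have hs' : Summable fun k => ‖(c k : ℂ) • (memLp_dilatedGaussianFourier d k).toLp‖ := by
    refine hs.congr fun k => ?_
    rw [← hterm, Lp.norm_fourier_eq]
  have h := Lp.hasSum_coeFn_tsum (tsum_enorm_ne_top_iff_summable_norm.2 hs')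
  have h1 : ∀ᵐ x, ∀ k, ((c k : ℂ) • (memLp_dilatedGaussianFourier d k).toLp :
      Lp ℂ 2 (volume : Measure (EuclideanSpace ℝ (Fin d)))) x =
      ((c k * dilatedGaussianFourier d k x : ℝ) : ℂ) := by
    rw [ae_all_iff]
    intro k
    filter_upwards [Lp.coeFn_smul (c k : ℂ) (memLp_dilatedGaussianFourier d k).toLp,
      (memLp_dilatedGaussianFourier d k).coeFn_toLp] with x hx hx'
    rw [hx, Pi.smul_apply, hx', smul_eq_mul, Complex.ofReal_mul]
  rw [htsum]
  filter_upwards [h, h1] with x hx hx1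
  simpa only [hx1] using hx

theorem lintegral_dilatedGaussianFourier (d k : ℕ) :
    ∫⁻ η, ENNReal.ofReal (dilatedGaussianFourier d k η) = 1 := by
  rw [← ofReal_integral_eq_lintegral_ofReal, integral_dilatedGaussianFourier, ENNReal.ofReal_one]
  · exact (integrable_exp_neg_mul_sq_norm (by positivity)).const_mul _
  · exact Filter.Eventually.of_forall fun η => dilatedGaussianFourier_nonneg η

theorem lintegral_weight_gaussianSeries_le {d : ℕ} (hd : 1 ≤ d) {c : ℕ → ℝ} {B C : ℝ}
    (hc : ∀ k, |c k| ≤ B)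
    (hC : ∀ (η : EuclideanSpace ℝ (Fin d)) (n : ℕ),
      (1 + (2 * Real.pi * ‖η‖) ^ 2) ^ ((d : ℝ) / 2) *
        ∑ k ∈ Finset.range n, dilatedGaussianFourier d k η ≤ C) :
    ∫⁻ η : EuclideanSpace ℝ (Fin d),
      ENNReal.ofReal ((1 + (2 * Real.pi * ‖η‖) ^ 2) ^ ((d : ℝ) / 2)) *
        ‖(𝓕 (gaussianSeries d c) :
          Lp ℂ 2 (volume : Measure (EuclideanSpace ℝ (Fin d)))) η‖ₑ ^ 2 ≤
      ∑' k, ENNReal.ofReal (C * c k ^ 2) := by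
  have hC0 : 0 ≤ C := by simpa using hC 0 0
  have hmeas (k : ℕ) : Measurable (dilatedGaussianFourier d k) := by
    unfold dilatedGaussianFourier; fun_prop
  calc _ ≤ ∫⁻ η : EuclideanSpace ℝ (Fin d), ∑' k, ENNReal.ofReal (C * c k ^ 2) *
        ENNReal.ofReal (dilatedGaussianFourier d k η) := by
        apply lintegral_mono_ae
        filter_upwards [fourier_gaussianSeries_ae_hasSum hd hc] with η hη
        -- Cauchy–Schwarz is available for partial sums; the inequality survives the pointwise
        -- limit.
        have hlim := hη.tendsto_sum_nat
        have hlim2 := ENNReal.Tendsto.const_mul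
          (a := ENNReal.ofReal ((1 + (2 * Real.pi * ‖η‖) ^ 2) ^ ((d : ℝ) / 2)))
          ((ENNReal.continuous_pow 2).continuousAt.tendsto.comp hlim.enorm)
          (Or.inr ENNReal.ofReal_ne_top)
        refine le_of_tendsto' hlim2 fun n => ?_
        refine le_trans ?_ (ENNReal.sum_le_tsum (Finset.range n))
        simp only [Function.comp_apply]
        rw [← Complex.ofReal_sum, ← ofReal_norm, Complex.norm_real, Real.norm_eq_abs,
          ← ENNReal.ofReal_pow (abs_nonneg _), sq_abs, ← ENNReal.ofReal_mul (by positivity)]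
        simp_rw [← ENNReal.ofReal_mul (mul_nonneg hC0 (sq_nonneg (c _)))]
        rw [← ENNReal.ofReal_sum_of_nonneg fun k _ => mul_nonneg
          (mul_nonneg hC0 (sq_nonneg _)) (dilatedGaussianFourier_nonneg η)]
        exact ENNReal.ofReal_le_ofReal (weight_mul_sq_sum_le hC c η n)
    _ = ∑' k, ENNReal.ofReal (C * c k ^ 2) := by
        rw [lintegral_tsum fun k => ((hmeas k).ennreal_ofReal.const_mul _).aemeasurable]
        congr 1
        funext k
        rw [lintegral_const_mul _ (hmeas k).ennreal_ofReal, lintegral_dilatedGaussianFourier,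
          mul_one]

/-! ### The unbounded function -/

/-- The ball of radius `L` in `H^{d/2}` contains a function which blows up at the origin. -/
theorem exists_mem_sobolevBall_unbounded {d : ℕ} (hd : 1 ≤ d) {L : ℝ} (hL : 0 < L) :
    ∃ f : UnitCube d → ℝ, Measurable f ∧ f ∈ sobolevBall d ((d : ℝ) / 2) L ∧
      ∀ K : ℝ, ∃ ρ : ℝ, 0 < ρ ∧
        ∀ᵐ x : UnitCube d ∂cubeVolume d, ‖(x : EuclideanSpace ℝ (Fin d))‖ < ρ → K ≤ f x := by
  obtain ⟨C, hC0, hC⟩ := exists_weight_mul_sum_le d hd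
  have hsum : Summable fun k : ℕ => (1 / ((k : ℝ) + 1)) ^ 2 := by
    have h := (summable_nat_add_iff 1).2 (Real.summable_one_div_nat_pow.2 (by norm_num : 1 < 2))
    refine h.congr fun k => ?_
    push_cast
    rw [div_pow, one_pow]
  set S := ∑' k : ℕ, (1 / ((k : ℝ) + 1)) ^ 2 with hS
  have hS0 : 0 ≤ S := tsum_nonneg fun k => by positivity
  -- Chosen so that `C ε² S ≤ L²`, because `C S ≤ (1 + C S)²`.
  set ε := L / (1 + C * S) with hε
  have hε0 : 0 < ε := by positivity
  set c : ℕ → ℝ := fun k => ε * (1 / ((k : ℝ) + 1)) with hcdef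
  have hc0 (k : ℕ) : 0 ≤ c k := by positivity
  have hc (k : ℕ) : |c k| ≤ ε := by
    rw [abs_of_nonneg (hc0 k)]
    apply mul_le_of_le_one_right hε0.le
    rw [div_le_one (by positivity)]
    linarith [show (0 : ℝ) ≤ k from Nat.cast_nonneg k]
  have hf (x : UnitCube d) : (∑' k, ENNReal.ofReal (c k * dilatedGaussian d k x)).toReal =
      ∑' k, c k * dilatedGaussian d k x := by
    rw [ENNReal.tsum_toReal_eq fun _ => ENNReal.ofReal_ne_top]
    refine tsum_congr fun k => ENNReal.toReal_ofReal ?_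
    exact mul_nonneg (hc0 k) (Real.exp_pos _).le
  have hae := ae_cubeVolume_of_ae (gaussianSeries_ae_hasSum hd hc)
  -- At the origin the sum is infinite and `toReal` returns 0, so the lower bound can only hold
  -- almost everywhere.
  refine ⟨fun x => (∑' k, ENNReal.ofReal (c k * dilatedGaussian d k x)).toReal, ?_, ?_, ?_⟩
  · refine (Measurable.tsum fun k => ?_).ennreal_toReal
    unfold dilatedGaussian
    fun_prop
  · change cubeSobolevNorm _ _ ≤ _
    refine (iInf₂_le (gaussianSeries d c) ?_).trans ?_
    · filter_upwards [hae] with x hx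
      rw [hf, ← hx.tsum_eq, Complex.ofReal_tsum]
    · rw [sobolevNorm, one_div, ENNReal.rpow_inv_le_iff (by norm_num)]
      refine (lintegral_weight_gaussianSeries_le hd hc hC).trans ?_
      rw [← ENNReal.ofReal_tsum_of_nonneg (fun k => by positivity)]
      · rw [ENNReal.ofReal_rpow_of_nonneg hL.le (by norm_num)]
        apply ENNReal.ofReal_le_ofReal
        simp only [hcdef, mul_pow]
        simp_rw [← mul_assoc]
        rw [tsum_mul_left, ← hS, hε]
        norm_num
        rw [div_pow, ← mul_div_assoc, div_mul_eq_mul_div, div_le_iff₀ (by positivity)]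
        have : 0 ≤ C * S := by positivity
        nlinarith [sq_nonneg (C * S), sq_nonneg L, mul_nonneg (sq_nonneg L) this,
          mul_nonneg (sq_nonneg L) (sq_nonneg (C * S))]
      · simp only [hcdef, mul_pow]
        exact (hsum.mul_left _).mul_left _
  · intro K
    -- On the ball of radius `4^{-N}` each Gaussian with `k < N` is at least `exp(-π)`; the harmonic
    -- series supplies `N`.
    obtain ⟨N, hN⟩ := ((Real.tendsto_sum_range_one_div_nat_succ_atTop.const_mul_atTop
      (show 0 < ε * Real.exp (-Real.pi) by positivity)).eventually_ge_atTop K).exists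
    refine ⟨(4 ^ N)⁻¹, by positivity, ?_⟩
    filter_upwards [hae] with x hx hxN
    have hx' : Summable fun k => c k * dilatedGaussian d k x := Complex.summable_ofReal.1 hx.summable
    rw [hf]
    refine hN.trans (le_trans ?_ (hx'.sum_le_tsum (Finset.range N)
      fun k _ => mul_nonneg (hc0 k) (Real.exp_pos _).le))
    rw [Finset.mul_sum]
    refine Finset.sum_le_sum fun k hk => ?_
    have hkN : k ≤ N := (Finset.mem_range.1 hk).le
    have h16 : ((16 : ℝ) ^ k) = (4 ^ k) ^ 2 := by
      rw [← pow_mul, mul_comm, pow_mul]; norm_num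
    have h1 : Real.exp (-Real.pi) ≤ dilatedGaussian d k x := by
      apply Real.exp_le_exp.2
      have h2 : 4 ^ k * ‖(x : EuclideanSpace ℝ (Fin d))‖ ≤ 1 := by
        calc _ ≤ 4 ^ N * ((4 : ℝ) ^ N)⁻¹ := by gcongr; norm_num
          _ = 1 := mul_inv_cancel₀ (by positivity)
      have h3 : (4 ^ k * ‖(x : EuclideanSpace ℝ (Fin d))‖) ^ 2 ≤ 1 :=
        pow_le_one₀ (by positivity) h2
      rw [h16, neg_mul, mul_assoc, ← mul_pow]
      nlinarith [Real.pi_pos]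
    calc _ = c k * Real.exp (-Real.pi) := by simp only [hcdef]; ring
      _ ≤ _ := by gcongr

/-! ### Mass near the origin and the two-radius inequality -/

/-- The origin is a corner of the cube, so the ball contains a nonempty open piece of the interior.
-/
theorem cubeVolume_norm_lt_ne_zero (d : ℕ) {ρ : ℝ} (hρ : 0 < ρ) :
    cubeVolume d {x | ‖(x : EuclideanSpace ℝ (Fin d))‖ < ρ} ≠ 0 := by
  have he : MeasurableEmbedding (Subtype.val : UnitCube d → _) :=
    MeasurableEmbedding.subtype_coe (measurableSet_unitCube d)
  rw [cubeVolume, he.comap_apply]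
  set U : Set (EuclideanSpace ℝ (Fin d)) := {x | ∀ i, x i ∈ Set.Ioo (0 : ℝ) 1} ∩ Metric.ball 0 ρ
  have hUo : IsOpen U := by
    refine IsOpen.inter ?_ Metric.isOpen_ball
    rw [Set.ofPred_forall]
    exact isOpen_iInter_of_finite fun i => isOpen_Ioo.preimage (by fun_prop)
  have hUn : U.Nonempty := by
    set v : EuclideanSpace ℝ (Fin d) := WithLp.toLp 2 fun _ => 1
    have hcont : Continuous fun t : ℝ => ‖t • v‖ := by fun_prop
    have h0 : ∀ᶠ t in nhdsWithin (0 : ℝ) (Set.Ioi 0), ‖t • v‖ < ρ :=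
      nhdsWithin_le_nhds (hcont.tendsto' 0 0 (by simp) (Iio_mem_nhds hρ))
    obtain ⟨t, ht, ht1⟩ := (h0.and (Ioo_mem_nhdsGT (zero_lt_one' ℝ))).exists
    exact ⟨t • v, fun i => by simpa [v] using ht1, by simpa using ht⟩
  have hsub : U ⊆ Subtype.val '' {x : UnitCube d | ‖(x : EuclideanSpace ℝ (Fin d))‖ < ρ} := by
    rintro x ⟨hx, hxρ⟩
    exact ⟨⟨x, fun i => Set.Ioo_subset_Icc_self (hx i)⟩, by simpa using hxρ, rfl⟩
  exact fun h => (hUo.measure_pos volume hUn).ne' (measure_mono_null hsub h)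

theorem IsCovariateLaw.apply_ne_zero {d : ℕ} {μ : Measure (UnitCube d)} (hμ : IsCovariateLaw μ)
    {S : Set (UnitCube d)} (hS : MeasurableSet S) (h : cubeVolume d S ≠ 0) : μ S ≠ 0 := by
  obtain ⟨-, p, c, C, -, hc, hp, rfl⟩ := hμ
  rw [withDensity_apply _ hS]
  have h1 : ENNReal.ofReal c * cubeVolume d S ≤ ∫⁻ x in S, ENNReal.ofReal (p x) ∂cubeVolume d := by
    rw [← setLIntegral_const]
    exact lintegral_mono fun x => ENNReal.ofReal_le_ofReal (hp x).1
  exact fun h0 => mul_ne_zero (ENNReal.ofReal_pos.2 hc).ne' h (le_antisymm (h1.trans h0.le) bot_le)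

/-- A continuous estimator that is close to `f` in mean square has a large adversarial risk as soon
as `f` takes very different values on two nearby sets. -/
theorem le_adversarialRisk_add_adversarialRisk {d n : ℕ} {μ : Measure (UnitCube d)}
    [IsProbabilityMeasure μ] {ν : Measure ℝ} [IsProbabilityMeasure ν]
    {F : (Fin n → UnitCube d × ℝ) → C(UnitCube d, ℝ)} (hF : ∀ x, Measurable fun D => F D x)
    {f : UnitCube d → ℝ} (hf : Measurable f) {A B : Set (UnitCube d)} (hA : MeasurableSet A)
    (hB : MeasurableSet B) {r r' K c : ℝ} (hr' : 0 ≤ r')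
    (hAB : ∀ x ∈ B, ∀ y ∈ A, dist y x ≤ r) (hK : ∀ y ∈ A, K ≤ f y) (hc : ∀ x ∈ B, f x ≤ c)
    (hcK : c ≤ K) :
    ENNReal.ofReal ((K - c) ^ 2 / 2) * μ A * μ B ≤
      μ A * adversarialRisk μ ν r F f + μ B * adversarialRisk μ ν r' F f := by
  set D : (Fin n → UnitCube d × ℝ) → (Fin n → UnitCube d × ℝ) :=
    fun z i => ((z i).1, f (z i).1 + (z i).2)
  have hD : Measurable D := by fun_prop
  set S : ℝ → (Fin n → UnitCube d × ℝ) → UnitCube d → ℝ≥0∞ := fun r z x =>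
    ⨆ x' ∈ Metric.closedBall x r, ENNReal.ofReal ((F (D z) x' - f x) ^ 2)
  set e : (Fin n → UnitCube d × ℝ) → UnitCube d → ℝ≥0∞ := fun z x =>
    ENNReal.ofReal ((F (D z) x - f x) ^ 2)
  have hS (t : ℝ) : adversarialRisk μ ν t F f =
    ∫⁻ z, ∫⁻ x, S t z x ∂μ ∂(Measure.pi fun _ : Fin n => μ.prod ν) := rfl
  -- Joint measurability comes from continuity in `x` and measurability in `z`. Integrals of sums
  -- below are split using measurability of the non-`S` summand only, so the supremum `S` need not
  -- be measurable.
  have he : Measurable (Function.uncurry e) := by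
    have h1 : Measurable (Function.uncurry fun x z => F (D z) x) :=
      measurable_uncurry_of_continuous_of_measurable (fun z => (F (D z)).continuous)
        fun x => (hF x).comp hD
    have h2 : Measurable fun p : (Fin n → UnitCube d × ℝ) × UnitCube d => F (D p.1) p.2 :=
      h1.comp measurable_swap
    exact ((h2.sub (hf.comp measurable_snd)).pow_const 2).ennreal_ofReal
  have hez (z) : Measurable (e z) := he.comp measurable_prodMk_left
  have hE : Measurable fun z => ∫⁻ x, e z x ∂μ := he.lintegral_prod_right
  -- With `a = F(y) - f(x)` and `b = F(y) - f(y)`, this is `(a - b)² ≤ 2a² + 2b²`.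
  have hpt (z) {x y} (hx : x ∈ B) (hy : y ∈ A) :
      ENNReal.ofReal ((K - c) ^ 2 / 2) ≤ S r z x + e z y := by
    have h1 : ENNReal.ofReal ((F (D z) y - f x) ^ 2) ≤ S r z x :=
      le_iSup₂_of_le y (Metric.mem_closedBall.2 (hAB x hx y hy)) le_rfl
    refine le_trans ?_ (add_le_add_left h1 _)
    rw [← ENNReal.ofReal_add (sq_nonneg _) (sq_nonneg _)]
    apply ENNReal.ofReal_le_ofReal
    have h2 : (K - c) ^ 2 ≤ (f y - f x) ^ 2 := by
      apply pow_le_pow_left₀ (by linarith)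
      linarith [hK y hy, hc x hx]
    nlinarith [sq_nonneg ((F (D z) y - f x) + (F (D z) y - f y))]
  have hx (z) {x} (hxB : x ∈ B) :
      ENNReal.ofReal ((K - c) ^ 2 / 2) * μ A ≤ μ A * S r z x + ∫⁻ y, e z y ∂μ := by
    calc _ = ∫⁻ _ in A, ENNReal.ofReal ((K - c) ^ 2 / 2) ∂μ := (setLIntegral_const _ _).symm
      _ ≤ ∫⁻ y in A, (S r z x + e z y) ∂μ := setLIntegral_mono' hA fun y hy => hpt z hxB hy
      _ = S r z x * μ A + ∫⁻ y in A, e z y ∂μ := by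
        rw [lintegral_add_right _ (hez z), setLIntegral_const]
      _ ≤ _ := by
        rw [mul_comm]
        gcongr
        exact Measure.restrict_le_self
  have hz (z) : ENNReal.ofReal ((K - c) ^ 2 / 2) * μ A * μ B ≤
      μ A * ∫⁻ x, S r z x ∂μ + μ B * ∫⁻ y, e z y ∂μ := by
    calc _ = ∫⁻ _ in B, ENNReal.ofReal ((K - c) ^ 2 / 2) * μ A ∂μ := (setLIntegral_const _ _).symm
      _ ≤ ∫⁻ x in B, (μ A * S r z x + ∫⁻ y, e z y ∂μ) ∂μ :=
        setLIntegral_mono' hB fun x hxB => hx z hxB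
      _ = μ A * ∫⁻ x in B, S r z x ∂μ + (∫⁻ y, e z y ∂μ) * μ B := by
        rw [lintegral_add_right _ measurable_const, setLIntegral_const,
          lintegral_const_mul' _ _ (measure_ne_top μ A)]
      _ ≤ _ := by
        rw [mul_comm _ (μ B)]
        gcongr
        exact Measure.restrict_le_self
  calc _ = ∫⁻ _, ENNReal.ofReal ((K - c) ^ 2 / 2) * μ A * μ B
        ∂(Measure.pi fun _ : Fin n => μ.prod ν) := by
        rw [lintegral_const, measure_univ, mul_one]
    _ ≤ ∫⁻ z, (μ A * ∫⁻ x, S r z x ∂μ + μ B * ∫⁻ y, e z y ∂μ)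
        ∂(Measure.pi fun _ : Fin n => μ.prod ν) := lintegral_mono hz
    _ = μ A * ∫⁻ z, ∫⁻ x, S r z x ∂μ ∂(Measure.pi fun _ : Fin n => μ.prod ν) +
        μ B * ∫⁻ z, ∫⁻ y, e z y ∂μ ∂(Measure.pi fun _ : Fin n => μ.prod ν) := by
        rw [lintegral_add_right _ (hE.const_mul _), lintegral_const_mul' _ _ (measure_ne_top μ A),
          lintegral_const_mul' _ _ (measure_ne_top μ B)]
    _ ≤ _ := by
        rw [hS, hS]
        gcongr with z x
        exact le_iSup₂_of_le x (Metric.mem_closedBall_self hr') le_rfl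

/-- The sublevel sets for `c ∈ ℕ` exhaust a ball of positive measure, so they cannot all be null. -/
theorem exists_measurableSet_le_ne_zero {d : ℕ} {μ : Measure (UnitCube d)} (hμ : IsCovariateLaw μ)
    (f : UnitCube d → ℝ) {ρ : ℝ} (hρ : 0 < ρ) :
    ∃ c : ℝ, μ {x | ‖(x : EuclideanSpace ℝ (Fin d))‖ < ρ ∧ f x ≤ c} ≠ 0 := by
  by_contra! h
  have hmeas : MeasurableSet {x : UnitCube d | ‖(x : EuclideanSpace ℝ (Fin d))‖ < ρ} :=
    measurableSet_lt (by fun_prop) measurable_const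
  refine hμ.apply_ne_zero hmeas (cubeVolume_norm_lt_ne_zero d hρ) ?_
  refine measure_mono_null (fun x hx => ?_) (measure_iUnion_null fun m : ℕ => h m)
  obtain ⟨m, hm⟩ := exists_nat_ge (f x)
  exact Set.mem_iUnion.2 ⟨m, hx, hm⟩

/-! ### Contradiction as the sample size grows -/

theorem theorem3p4 (d : ℕ) (hd : 1 ≤ d) (L : ℝ) (hL : 0 < L) :
    ∃ f_ill : UnitCube d → ℝ, Measurable f_ill ∧ f_ill ∈ sobolevBall d ((d : ℝ) / 2) L ∧
      ∀ (s : ℝ), 0 < s →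
      ∀ (μ : Measure (UnitCube d)), IsCovariateLaw μ →
      ∀ (σ : ℝ≥0) (ν : Measure ℝ), IsNoiseLaw σ ν →
      ∀ (r₀ : ℝ), 0 < r₀ →
        ¬ ∃ (F : (n : ℕ) → (Fin n → UnitCube d × ℝ) → C(UnitCube d, ℝ)) (M : ℝ),
          IsEstimator F ∧
          ∀ (n : ℕ), 1 ≤ n → ∀ (r : ℝ), 0 < r → r ≤ r₀ →
            adversarialRisk μ ν r (F n) f_ill ≤
              ENNReal.ofReal
                (M * ((n : ℝ) ^ (-(2 * s) / (2 * s + d)) + r ^ (2 * min 1 s))) := by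
  obtain ⟨f, hf, hfL, hfK⟩ := exists_mem_sobolevBall_unbounded hd hL
  refine ⟨f, hf, hfL, ?_⟩
  rintro s hs μ hμ σ ν hν r₀ hr₀ ⟨F, M, hF, hrisk⟩
  have := hμ.1
  have := hν.1
  obtain ⟨c, hc⟩ := exists_measurableSet_le_ne_zero hμ f (half_pos hr₀)
  set B : Set (UnitCube d) := {x | ‖(x : EuclideanSpace ℝ (Fin d))‖ < r₀ / 2 ∧ f x ≤ c} with hBdef
  have hB : MeasurableSet B := by
    refine MeasurableSet.inter ?_ (measurableSet_le hf measurable_const)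
    exact measurableSet_lt measurable_subtype_coe.norm measurable_const
  set p := -(2 * s) / (2 * s + d) with hp
  set q := 2 * min 1 s with hq
  have hp0 : p < 0 := div_neg_of_neg_of_pos (by linarith) (by positivity)
  have hq0 : 0 < q := by positivity
  set Q := ENNReal.ofReal (|M| * (1 + r₀ ^ q)) with hQ
  -- `B` and `Q` are fixed before the height of the peak. The set `A` depends on `t` and may be
  -- tiny, but `μ A` cancels in the limit, leaving `t ≤ Q / μ B`.
  set t := (Q / μ B).toReal + 1 with ht
  have ht0 : 0 ≤ (Q / μ B).toReal := ENNReal.toReal_nonneg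
  obtain ⟨ρ, hρ, hρK⟩ := hfK (c + 1 + t)
  set A : Set (UnitCube d) :=
    {x | ‖(x : EuclideanSpace ℝ (Fin d))‖ < min ρ (r₀ / 2) ∧ c + 1 + t ≤ f x} with hAdef
  have hAmeas : MeasurableSet A := by
    refine MeasurableSet.inter ?_ (measurableSet_le measurable_const hf)
    exact measurableSet_lt measurable_subtype_coe.norm measurable_const
  have hA : μ A ≠ 0 := by
    apply hμ.apply_ne_zero hAmeas
    intro h0
    refine cubeVolume_norm_lt_ne_zero d (lt_min hρ (half_pos hr₀)) ?_
    rw [← h0]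
    apply measure_congr
    filter_upwards [hρK] with x hx
    exact propext ⟨fun h => ⟨h, hx (h.trans_le (min_le_left _ _))⟩, fun h => h.1⟩
  -- The radius `r₀ / (n + 1)` is coupled to the sample size `n + 1`, so both terms of the rate
  -- vanish together.
  have hmain (n : ℕ) : ENNReal.ofReal t * μ A * μ B ≤
      μ A * Q + μ B * ENNReal.ofReal
        (M * (((n + 1 : ℕ) : ℝ) ^ p + (r₀ / ((n + 1 : ℕ) : ℝ)) ^ q)) := by
    have hn : (1 : ℝ) ≤ ((n + 1 : ℕ) : ℝ) := by exact_mod_cast Nat.le_add_left 1 n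
    have hn0 : (0 : ℝ) < ((n + 1 : ℕ) : ℝ) := by linarith
    have h1 := le_adversarialRisk_add_adversarialRisk (μ := μ) (ν := ν) (hF (n + 1)) hf hAmeas hB
      (r := r₀) (r' := r₀ / ((n + 1 : ℕ) : ℝ)) (K := c + 1 + t) (c := c) (by positivity)
      (fun x hx y hy => by
        have h2 := hy.1.trans_le (min_le_right _ _)
        have h3 := dist_le_norm_add_norm (y : EuclideanSpace ℝ (Fin d)) x
        rw [Subtype.dist_eq]
        linarith [hx.1])
      (fun y hy => hy.2) (fun x hx => hx.2) (by linarith)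
    have h2 := hrisk (n + 1) (Nat.le_add_left 1 n) r₀ hr₀ le_rfl
    have h3 := hrisk (n + 1) (Nat.le_add_left 1 n) (r₀ / ((n + 1 : ℕ) : ℝ)) (by positivity)
      (div_le_self hr₀.le hn)
    have h4 : ENNReal.ofReal (M * (((n + 1 : ℕ) : ℝ) ^ p + r₀ ^ q)) ≤ Q := by
      apply ENNReal.ofReal_le_ofReal
      have h5 : ((n + 1 : ℕ) : ℝ) ^ p ≤ 1 := Real.rpow_le_one_of_one_le_of_nonpos hn hp0.le
      calc _ ≤ |M| * (((n + 1 : ℕ) : ℝ) ^ p + r₀ ^ q) := by gcongr; exact le_abs_self M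
        _ ≤ _ := by gcongr
    -- The extra 1 in the gap `1 + t` gives `(1 + t)² / 2 ≥ t`.
    have h5 : ENNReal.ofReal t ≤ ENNReal.ofReal ((c + 1 + t - c) ^ 2 / 2) := by
      apply ENNReal.ofReal_le_ofReal
      nlinarith [sq_nonneg t]
    calc _ ≤ _ := by gcongr
      _ ≤ _ := h1
      _ ≤ _ := by gcongr; exact h2.trans h4
  have hlim : Filter.Tendsto (fun n : ℕ => μ A * Q + μ B * ENNReal.ofReal
      (M * (((n + 1 : ℕ) : ℝ) ^ p + (r₀ / ((n + 1 : ℕ) : ℝ)) ^ q))) Filter.atTop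
      (nhds (μ A * Q + μ B * ENNReal.ofReal (M * (0 + 0)))) := by
    have hN : Filter.Tendsto (fun n : ℕ => ((n + 1 : ℕ) : ℝ)) Filter.atTop Filter.atTop :=
      tendsto_natCast_atTop_atTop.comp (Filter.tendsto_add_atTop_nat 1)
    have h1 : Filter.Tendsto (fun n : ℕ => ((n + 1 : ℕ) : ℝ) ^ p) Filter.atTop (nhds 0) := by
      have := (tendsto_rpow_neg_atTop (neg_pos.2 hp0)).comp hN
      simp only [neg_neg] at this
      exact this
    have h2 : Filter.Tendsto (fun n : ℕ => (r₀ / ((n + 1 : ℕ) : ℝ)) ^ q) Filter.atTop (nhds 0) := by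
      have := (hN.const_div_atTop r₀).rpow_const (p := q) (Or.inr hq0.le)
      rwa [Real.zero_rpow hq0.ne'] at this
    exact tendsto_const_nhds.add (ENNReal.Tendsto.const_mul
      (ENNReal.tendsto_ofReal ((h1.add h2).const_mul M)) (Or.inr (measure_ne_top μ B)))
  have hle := ge_of_tendsto' hlim hmain
  rw [add_zero, mul_zero, ENNReal.ofReal_zero, mul_zero, add_zero, mul_comm _ (μ A), mul_assoc,
    ENNReal.mul_le_mul_iff_right hA (measure_ne_top μ A),
    ← ENNReal.le_div_iff_mul_le (Or.inl hc) (Or.inl (measure_ne_top μ B))] at hle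
  have hQB : Q / μ B ≠ ∞ := ENNReal.div_ne_top ENNReal.ofReal_ne_top hc
  have := (ENNReal.ofReal_le_iff_le_toReal hQB).1 hle
  linarith
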